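/- Let $n\ge 2$ be the dimension and $0<s<1$. Let $\Omega\subset\mathbb{R}^n$ be a bounded domain with $C^{1,1}$ boundary, $\Omega_e:=\mathbb{R}^n\setminus\overline{\Omega}$, and let $r>0$ satisfy $\Omega\subset B_r(0)$. Let $A=(A_1,\dots,A_n):\mathbb{R}^n\to\mathbb{R}^n$ be measurable, with $A=0$ almost everywhere outside $B_r(0)$ and $|A_j|\le \pi/(8\sqrt{n}\,r)$ almost everywhere for $j=1,\dots,n$. All functions are real-valued. Write $$K(x,y):=\frac{c_{n,s}}{|x-y|^{n+2s}},\qquad c_{n,s}:=\frac{4^s\,\Gamma(\frac n2+s)}{2\,\pi^{n/2}\,|\Gamma(-s)|},$$ and for $u,v\in H^s(\mathbb{R}^n)$ $$\langle \mathcal{R}^s_Au,v\rangle:=\mathrm{Re}\iint_{\mathbb{R}^n\times\mathbb{R}^n}\bigl(u(x)-e^{i(x-y)\cdot A(\frac{x+y}{2})}u(y)\bigr)\bigl(v(x)-e^{-i(x-y)\cdot A(\frac{x+y}{2})}v(y)\bigr)K(x,y)\,dx\,dy,$$ where $H^s(\mathbb{R}^n)$ has the norm $\bigl(\|u\|_{L^2}^2+\iint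 |u(x)-u(y)|^2|x-y|^{-n-2s}\,dx\,dy\bigr)^{1/2}$. Let $\tilde H^s(\Omega)$ be the closure of $C_c^\infty(\Omega)$ in $H^s(\mathbb{R}^n)$. **Proposition 3.6.** For every $c>0$ there is a constant $C>0$, depending only on $c$, with the following property. Let $q\in L^\infty(\Omega)$ with $q\ge c$ almost everywhere in $\Omega$, let $f\in L^\infty(\Omega)$ and $g\in C_c^\infty(\Omega_e)$, and let $u\in H^s(\mathbb{R}^n)$ be a weak solution of $$(\mathcal{R}^s_A+q)u=f\ \text{ in }\Omega,\qquad u=g\ \text{ in }\Omega_e,$$ that is, $u=g$ almost everywhere in $\Omega_e$ and $\langle\mathcal{R}^s_Au,v\rangle+\int_\Omega quv\,dx=\int_\Omega fv\,dx$ for all $v\in\tilde H^s(\Omega)$. Then $$\|u\|_{L^\infty(\mathbb{R}^n)}\le C\,\|f\|_{L^\infty(\Omega)}+\|g\|_{L^\infty(\Omega_e)}.$$ -/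

import Mathlib

open MeasureTheory
open scoped ENNReal NNReal ContDiff

noncomputable section

namespace FracMagnetic

/-- Euclidean space `ℝⁿ`. -/
abbrev E (n : ℕ) := EuclideanSpace ℝ (Fin n)

variable {n : ℕ}

/-- `ν` is a unit vector and `γ` a `C^{1,1}` function on the hyperplane orthogonal to `ν` such that
inside the ball `B_ρ(p)` the set `Ω` is the part lying strictly above the graph of `γ`, the
direction `ν` being "up". -/
def IsC11GraphNear (Ω : Set (E n)) (p : E n) (ρ : ℝ) (ν : E n)
    (γ : (ℝ ∙ ν)ᗮ → ℝ) : Prop :=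
  ‖ν‖ = 1 ∧ ContDiff ℝ 1 γ ∧ (∃ K : ℝ≥0, LipschitzWith K (fderiv ℝ γ)) ∧
    ∀ x ∈ Metric.ball p ρ,
      (x ∈ Ω ↔ γ ((ℝ ∙ ν)ᗮ.orthogonalProjectionOnto x) < inner ℝ ν x)

/-- The boundary of `Ω` is of class `C^{1,1}`. -/
def HasC11Boundary (Ω : Set (E n)) : Prop :=
  ∀ p ∈ frontier Ω, ∃ (ρ : ℝ) (ν : E n) (γ : (ℝ ∙ ν)ᗮ → ℝ),
    0 < ρ ∧ IsC11GraphNear Ω p ρ ν γ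

/-- Bounded domains (nonempty connected open sets) with `C^{1,1}` boundary. -/
structure IsBoundedC11Domain (Ω : Set (E n)) : Prop where
  isOpen : IsOpen Ω
  isConnected : IsConnected Ω
  isBounded : Bornology.IsBounded Ω
  boundary : HasC11Boundary Ω

/-- The exterior `Ω_e = ℝⁿ \ closure Ω`. -/
def exterior (Ω : Set (E n)) : Set (E n) := (closure Ω)ᶜ

/-- `φ ∈ C_c^∞(U)`, as a function on `ℝⁿ`. -/
structure IsTestFunction (U : Set (E n)) (φ : E n → ℝ) : Prop where
  contDiff : ContDiff ℝ ∞ φ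
  hasCompactSupport : HasCompactSupport φ
  tsupport_subset : tsupport φ ⊆ U

/-- `∬ |u(x) - u(y)|² / |x - y|^{n+2s} dx dy`, with values in `[0, ∞]`. -/
def gagliardoSq (s : ℝ) (u : E n → ℝ) : ℝ≥0∞ :=
  ∫⁻ z : E n × E n, ENNReal.ofReal (|u z.1 - u z.2| ^ 2 / ‖z.1 - z.2‖ ^ ((n : ℝ) + 2 * s))

/-- The norm `(‖u‖²_{L²} + ∬ |u(x) - u(y)|² / |x - y|^{n+2s} dx dy)^{1/2}` of `H^s(ℝⁿ)`,
`0 < s < 1`, with values in `[0, ∞]`. -/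
def sobolevNorm (s : ℝ) (u : E n → ℝ) : ℝ≥0∞ :=
  (eLpNorm u 2 volume ^ 2 + gagliardoSq s u) ^ (1 / 2 : ℝ)

/-- The real-valued function `u` belongs to `H^s(ℝⁿ)`, `0 < s < 1`. -/
def MemHs (s : ℝ) (u : E n → ℝ) : Prop :=
  AEStronglyMeasurable u volume ∧ sobolevNorm s u < ⊤

/-- `v` belongs to the closure of `C_c^∞(Ω)` in `H^s(ℝⁿ)`. -/
def MemHsTilde (s : ℝ) (Ω : Set (E n)) (v : E n → ℝ) : Prop :=
  MemHs s v ∧ ∀ ε : ℝ≥0∞, 0 < ε → ∃ φ : E n → ℝ, IsTestFunction Ω φ ∧ sobolevNorm s (v - φ) < ε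

/-- The constant `c_{n,s}`: half of the usual constant `4^s Γ(n/2 + s) / (π^{n/2} |Γ(-s)|)`, so that
`(-Δ)^s u(x) = 2 p.v. ∫ (u(x) - u(y)) c_{n,s} / |x - y|^{n+2s} dy`. -/
def kernelConst (n : ℕ) (s : ℝ) : ℝ :=
  (4 : ℝ) ^ s * Real.Gamma ((n : ℝ) / 2 + s) / (2 * Real.pi ^ ((n : ℝ) / 2) * |Real.Gamma (-s)|)

/-- `K(x, y) = c_{n,s} / |x - y|^{n+2s}`. -/
def kernel (s : ℝ) (x y : E n) : ℝ :=
  kernelConst n s / ‖x - y‖ ^ ((n : ℝ) + 2 * s)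

/-- The phase `(x - y) · A((x + y) / 2)`. -/
def phase (A : E n → E n) (x y : E n) : ℝ :=
  inner ℝ (x - y) (A ((1 / 2 : ℝ) • (x + y)))

/-- The bilinear form
`⟨𝓡^s_A u, v⟩ = Re ∬ (u(x) - e^{iθ(x,y)} u(y)) (v(x) - e^{-iθ(x,y)} v(y)) K(x, y) dx dy`,
where `θ(x, y) = (x - y) · A((x + y) / 2)`. -/
def magneticForm (s : ℝ) (A : E n → E n) (u v : E n → ℝ) : ℝ :=
  (∫ z : E n × E n,
    ((u z.1 : ℂ) - Complex.exp (Complex.I * (phase A z.1 z.2 : ℂ)) * (u z.2 : ℂ)) *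
    ((v z.1 : ℂ) - Complex.exp (-(Complex.I * (phase A z.1 z.2 : ℂ))) * (v z.2 : ℂ)) *
    (kernel s z.1 z.2 : ℂ)).re

/-- `u ∈ H^s(ℝⁿ)` is a weak solution of `(𝓡^s_A + q) u = f` in `Ω`, `u = g` in `Ω_e`. -/
structure IsWeakSolution (s : ℝ) (A : E n → E n) (Ω : Set (E n)) (q f g u : E n → ℝ) : Prop where
  memHs : MemHs s u
  eq_exterior : ∀ᵐ x ∂(volume.restrict (exterior Ω)), u x = g x
  weak_eq : ∀ v : E n → ℝ, MemHsTilde s Ω v →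
    magneticForm s A u v + ∫ x in Ω, q x * u x * v x = ∫ x in Ω, f x * v x

end FracMagnetic

end

open MeasureTheory
open scoped ENNReal NNReal ContDiff
open Filter Topology Convolution Pointwise

namespace FracMagnetic

variable {n : ℕ}


/-! The proof is a weak maximum principle by truncation. With `F`, `G` the sup norms of `f` and `g`,
put `M = F / c + G` and test the equation with `v = (u - M)⁺`, which vanishes a.e. outside `Ω`. The
real part of the integrand of the form is `(u(x)v(x) + u(y)v(y) - cos θ (u(x)v(y) + u(y)v(x))) K`,
nonnegative whenever `0 ≤ cos θ` (`integrand_nonneg`). The bound on `A` gives `|θ| ≤ π/2` if the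
midpoint and one of the two points lie in `B_r`; for other pairs either `A` vanishes at the midpoint
or `v` vanishes at both points. So the form is nonnegative and `∫ (q u - f) v ≤ 0`. But `q u - f ≥ c
v` where `u > M`, hence `v = 0` and `u ≤ M`. The same bound for `-u` gives the theorem with `C = 1 /
c`.

Most of the work is admissibility of `v`: a function of `H^s(ℝⁿ)` vanishing a.e. outside `Ω` lies in
the closure of the test functions (`memHsTilde_of_ae_eq_zero`). It is localized by a partition of
unity, each piece is pushed slightly into `Ω` and then mollified. Of the boundary regularity only
the continuity of the local graphs enters. -/

/-! ### The Sobolev energy -/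

/-- The weight `|h|^{-n-2s}`. -/
noncomputable def singularWeight (s : ℝ) (h : E n) : ℝ≥0∞ :=
  ENNReal.ofReal ((‖h‖ ^ ((n : ℝ) + 2 * s))⁻¹)

/-- The square of the Sobolev norm, as a sum of two lower integrals. -/
noncomputable def sobolevEnergy (s : ℝ) (u : E n → ℝ) : ℝ≥0∞ :=
  (∫⁻ x, ‖u x‖ₑ ^ 2) + ∫⁻ z : E n × E n, ‖u z.1 - u z.2‖ₑ ^ 2 * singularWeight s (z.1 - z.2)

@[fun_prop]
lemma measurable_singularWeight (s : ℝ) : Measurable (singularWeight s : E n → ℝ≥0∞) := by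
  unfold singularWeight
  fun_prop

lemma eLpNorm_two_sq {α : Type*} [MeasurableSpace α] (μ : Measure α) (f : α → ℝ) :
    eLpNorm f 2 μ ^ 2 = ∫⁻ x, ‖f x‖ₑ ^ 2 ∂μ := by
  rw [eLpNorm_eq_lintegral_rpow_enorm_toReal (by norm_num) (by norm_num)]
  rw [← ENNReal.rpow_natCast, ← ENNReal.rpow_mul]
  simp

lemma sobolevNorm_eq (s : ℝ) (u : E n → ℝ) :
    sobolevNorm s u = sobolevEnergy s u ^ (1 / 2 : ℝ) := by
  unfold sobolevNorm sobolevEnergy gagliardoSq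
  rw [eLpNorm_two_sq]
  congr 2
  refine lintegral_congr fun z => ?_
  rw [div_eq_mul_inv, ENNReal.ofReal_mul (by positivity), singularWeight,
    ENNReal.ofReal_pow (abs_nonneg _), ← Real.norm_eq_abs, ofReal_norm]

lemma sobolevNorm_lt_top_iff {s : ℝ} {u : E n → ℝ} :
    sobolevNorm s u < ⊤ ↔ sobolevEnergy s u < ⊤ := by
  rw [sobolevNorm_eq, ENNReal.rpow_lt_top_iff_of_pos (by norm_num)]

lemma memHs_iff {s : ℝ} {u : E n → ℝ} :
    MemHs s u ↔ AEStronglyMeasurable u volume ∧ sobolevEnergy s u < ⊤ := by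
  rw [MemHs, sobolevNorm_lt_top_iff]

lemma memLp_two_of_sobolevEnergy_lt_top {s : ℝ} {u : E n → ℝ} (hu : AEStronglyMeasurable u volume)
    (h : sobolevEnergy s u < ⊤) : MemLp u 2 volume := by
  refine ⟨hu, ?_⟩
  have : eLpNorm u 2 volume ^ 2 < ⊤ := by
    rw [eLpNorm_two_sq]
    exact lt_of_le_of_lt le_self_add h
  simpa using this

lemma ae_prod_of_ae {p : E n → Prop} (h : ∀ᵐ x, p x) :
    ∀ᵐ z : E n × E n, p z.1 ∧ p z.2 := by
  have h1 := (Measure.quasiMeasurePreserving_fst (μ := (volume : Measure (E n)))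
    (ν := (volume : Measure (E n)))).ae h
  have h2 := (Measure.quasiMeasurePreserving_snd (μ := (volume : Measure (E n)))
    (ν := (volume : Measure (E n)))).ae h
  rw [Measure.volume_eq_prod]
  filter_upwards [h1, h2] with z a b using ⟨a, b⟩

lemma sobolevEnergy_congr_ae {s : ℝ} {u v : E n → ℝ} (h : u =ᵐ[volume] v) :
    sobolevEnergy s u = sobolevEnergy s v := by
  unfold sobolevEnergy
  congr 1
  · refine lintegral_congr_ae ?_
    filter_upwards [h] with x hx
    rw [hx]
  · refine lintegral_congr_ae ?_
    filter_upwards [ae_prod_of_ae h] with z hz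
    rw [hz.1, hz.2]

lemma sobolevEnergy_mono {s : ℝ} {u v : E n → ℝ} (h : ∀ᵐ x, |u x| ≤ |v x|)
    (h' : ∀ᵐ z : E n × E n, |u z.1 - u z.2| ≤ |v z.1 - v z.2|) :
    sobolevEnergy s u ≤ sobolevEnergy s v := by
  unfold sobolevEnergy
  gcongr ?_ + ?_
  · refine lintegral_mono_ae ?_
    filter_upwards [h] with x hx
    gcongr ?_ ^ 2
    exact enorm_le_iff_norm_le.2 hx
  · refine lintegral_mono_ae ?_
    filter_upwards [h'] with z hz
    gcongr ?_ ^ 2 * _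
    exact enorm_le_iff_norm_le.2 hz

lemma enorm_add_sq_le (a b : ℝ) : ‖a + b‖ₑ ^ 2 ≤ 2 * ‖a‖ₑ ^ 2 + 2 * ‖b‖ₑ ^ 2 := by
  calc ‖a + b‖ₑ ^ 2 = ENNReal.ofReal (‖a + b‖ ^ 2) := by
        rw [ENNReal.ofReal_pow (norm_nonneg _), ofReal_norm]
    _ ≤ ENNReal.ofReal (2 * ‖a‖ ^ 2 + 2 * ‖b‖ ^ 2) := by
        refine ENNReal.ofReal_le_ofReal ?_
        simp only [Real.norm_eq_abs, sq_abs]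
        nlinarith [sq_nonneg (a - b)]
    _ = 2 * ‖a‖ₑ ^ 2 + 2 * ‖b‖ₑ ^ 2 := by
        rw [ENNReal.ofReal_add (by positivity) (by positivity), ENNReal.ofReal_mul (by norm_num),
          ENNReal.ofReal_mul (by norm_num), ENNReal.ofReal_pow (norm_nonneg _),
          ENNReal.ofReal_pow (norm_nonneg _), ofReal_norm, ofReal_norm]
        simp

lemma lintegral_mul_enorm_add_sq_le {α : Type*} [MeasurableSpace α] {μ : Measure α} {a b : α → ℝ}
    {k : α → ℝ≥0∞} (ha : AEMeasurable a μ) (hk : AEMeasurable k μ) :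
    ∫⁻ x, ‖a x + b x‖ₑ ^ 2 * k x ∂μ ≤
      2 * (∫⁻ x, ‖a x‖ₑ ^ 2 * k x ∂μ) + 2 * ∫⁻ x, ‖b x‖ₑ ^ 2 * k x ∂μ := by
  rw [← lintegral_const_mul' _ _ (by simp), ← lintegral_const_mul' _ _ (by simp),
    ← lintegral_add_left' (by fun_prop)]
  refine lintegral_mono fun x => ?_
  calc _ ≤ (2 * ‖a x‖ₑ ^ 2 + 2 * ‖b x‖ₑ ^ 2) * k x := by gcongr; exact enorm_add_sq_le _ _
    _ = _ := by ring

lemma AEMeasurable.diff_prod {u : E n → ℝ} (hu : AEMeasurable u) :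
    AEMeasurable (fun z : E n × E n => u z.1 - u z.2) :=
  (hu.comp_quasiMeasurePreserving Measure.quasiMeasurePreserving_fst).sub
    (hu.comp_quasiMeasurePreserving Measure.quasiMeasurePreserving_snd)

lemma sobolevEnergy_add_le {s : ℝ} {u v : E n → ℝ} (hu : AEMeasurable u) :
    sobolevEnergy s (fun x => u x + v x) ≤ 2 * sobolevEnergy s u + 2 * sobolevEnergy s v := by
  unfold sobolevEnergy
  have h1 := lintegral_mul_enorm_add_sq_le (b := v) (k := fun _ => 1) hu aemeasurable_const
  have h2 := lintegral_mul_enorm_add_sq_le (b := fun z : E n × E n => v z.1 - v z.2)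
    (k := fun z : E n × E n => singularWeight s (z.1 - z.2)) (AEMeasurable.diff_prod hu)
    (by fun_prop)
  simp only [mul_one] at h1
  simp only [add_sub_add_comm]
  calc _ ≤ _ := add_le_add h1 h2
    _ = _ := by ring

lemma memHsTilde_of_energy {s : ℝ} {Ω : Set (E n)} {v : E n → ℝ} (hv : MemHs s v)
    (h : ∀ ε : ℝ≥0∞, 0 < ε → ∃ φ : E n → ℝ, IsTestFunction Ω φ ∧
      sobolevEnergy s (fun x => v x - φ x) < ε) : MemHsTilde s Ω v := by
  refine ⟨hv, fun ε hε => ?_⟩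
  obtain ⟨φ, hφ, hφ'⟩ := h (ε ^ (2 : ℝ)) (ENNReal.rpow_pos_of_nonneg hε (by norm_num))
  refine ⟨φ, hφ, ?_⟩
  rw [sobolevNorm_eq]
  calc _ < (ε ^ (2 : ℝ)) ^ (1 / 2 : ℝ) := ENNReal.rpow_lt_rpow hφ' (by norm_num)
    _ = ε := by rw [← ENNReal.rpow_mul]; norm_num

/-! ### Translation and mollification in `H^s` -/

/-- Continuity of translations in `L²`, along a continuous family of translation vectors. -/
lemma tendsto_eLpNorm_sub_translate {X Y : Type*} [TopologicalSpace Y] [NormedAddCommGroup X]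
    [MeasurableSpace X] [BorelSpace X] [LocallyCompactSpace X]
    {μ : Measure X} [IsLocallyFiniteMeasure μ] [μ.InnerRegularCompactLTTop]
    [μ.IsAddRightInvariant] {f : X → ℝ} (hf : MemLp f 2 μ) {L : Y → X} (hL : Continuous L) {y₀ : Y}
    (h₀ : L y₀ = 0) :
    Tendsto (fun y => eLpNorm (fun x => f x - f (x - L y)) 2 μ) (𝓝 y₀) (𝓝 0) := by
  have : Fact ((1 : ℝ≥0∞) ≤ 2) := ⟨by norm_num⟩
  let G : C(Y × X, X) := ⟨fun p => p.2 - L p.1, by fun_prop⟩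
  have hG : ∀ y, MeasurePreserving (G.curry y) μ μ := fun y => measurePreserving_sub_right μ (L y)
  have hcont : Continuous fun y => Lp.compMeasurePreserving (G.curry y) (hG y) (hf.toLp f) :=
    Continuous.compMeasurePreservingLp continuous_const G.curry.continuous hG (by norm_num)
  have ht := hcont.tendsto y₀
  rw [tendsto_iff_edist_tendsto_0] at ht
  refine ht.congr fun y => ?_
  simp only [Lp.toLp_compMeasurePreserving]
  rw [Lp.edist_toLp_toLp, eLpNorm_sub_comm]
  refine congrArg (fun F => eLpNorm F 2 μ) ?_
  ext x
  simp [G, h₀]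


/-- Absorbing the root of the weight turns the Gagliardo seminorm into an `L²` norm on the product
space, where continuity of translations is available. -/
lemma enorm_sq_mul_singularWeight (s : ℝ) (a : ℝ) (h : E n) :
    ‖a‖ₑ ^ 2 * singularWeight s h = ‖a * √((‖h‖ ^ ((n : ℝ) + 2 * s))⁻¹)‖ₑ ^ 2 := by
  rw [enorm_mul, mul_pow, singularWeight]
  congr 1
  rw [← ofReal_norm, ← ENNReal.ofReal_pow (norm_nonneg _), Real.norm_eq_abs, sq_abs,
    Real.sq_sqrt (by positivity)]

/-- Translations are continuous in `H^s`. -/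
lemma tendsto_sobolevEnergy_sub_translate {s : ℝ} {w : E n → ℝ} (hw : Measurable w)
    (hw' : sobolevEnergy s w < ⊤) :
    Tendsto (fun h : E n => sobolevEnergy s (fun x => w x - w (x - h))) (𝓝 0) (𝓝 0) := by
  set κ : E n → ℝ := fun h => √((‖h‖ ^ ((n : ℝ) + 2 * s))⁻¹) with hκ
  have hκm : Measurable κ := by fun_prop
  set W : E n × E n → ℝ := fun z => (w z.1 - w z.2) * κ (z.1 - z.2) with hW
  have hWm : Measurable W := by fun_prop
  have h1 : MemLp w 2 volume :=
    memLp_two_of_sobolevEnergy_lt_top hw.aestronglyMeasurable hw'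
  have h2 : MemLp W 2 volume := by
    refine ⟨hWm.aestronglyMeasurable, ?_⟩
    have : eLpNorm W 2 volume ^ 2 < ⊤ := by
      rw [eLpNorm_two_sq]
      simp only [hW, hκ, ← enorm_sq_mul_singularWeight]
      exact lt_of_le_of_lt le_add_self hw'
    simpa using this
  have : (volume : Measure (E n × E n)).IsAddRightInvariant := by
    rw [Measure.volume_eq_prod]; infer_instance
  have t1 := tendsto_eLpNorm_sub_translate h1 (L := fun h : E n => h) continuous_id (y₀ := 0) rfl
  -- The diagonal shift `(h, h)` leaves `x - y`, and so the weight, unchanged.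
  have t2 := tendsto_eLpNorm_sub_translate h2 (L := fun h : E n => (h, h)) (by fun_prop)
    (y₀ := 0) rfl
  have t := ((ENNReal.continuous_pow 2).tendsto 0 |>.comp t1).add
    ((ENNReal.continuous_pow 2).tendsto 0 |>.comp t2)
  simp only [ne_eq, OfNat.ofNat_ne_zero, not_false_eq_true, zero_pow, add_zero] at t
  refine t.congr fun h => ?_
  simp only [Function.comp_apply, eLpNorm_two_sq, sobolevEnergy]
  congr 1
  refine lintegral_congr fun z => ?_
  rw [enorm_sq_mul_singularWeight]
  congr 2
  simp only [hW, hκ, Prod.fst_sub, Prod.snd_sub, sub_sub_sub_cancel_right]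
  ring

lemma enorm_integral_sq_le {α : Type*} [MeasurableSpace α] {μ : Measure α} [IsProbabilityMeasure μ]
    {F : α → ℝ} (hF : AEStronglyMeasurable F μ) :
    ‖∫ x, F x ∂μ‖ₑ ^ 2 ≤ ∫⁻ x, ‖F x‖ₑ ^ 2 ∂μ := by
  rw [← eLpNorm_two_sq]
  gcongr
  calc _ ≤ ∫⁻ x, ‖F x‖ₑ ∂μ := enorm_integral_le_lintegral_enorm _
    _ = eLpNorm F 1 μ := eLpNorm_one_eq_lintegral_enorm.symm
    _ ≤ _ := eLpNorm_le_eLpNorm_of_exponent_le (by norm_num) hF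

/-- Averaging translates: Minkowski's inequality for the Sobolev energy. -/
lemma sobolevEnergy_sub_average_le {s : ℝ} {w : E n → ℝ} (hw : Measurable w)
    (μ : Measure (E n)) [IsProbabilityMeasure μ] (hμ : ∀ x, Integrable (fun h => w (x - h)) μ) :
    sobolevEnergy s (fun x => w x - ∫ h, w (x - h) ∂μ) ≤
      ∫⁻ h, sobolevEnergy s (fun x => w x - w (x - h)) ∂μ := by
  have e : ∀ x, w x - ∫ h, w (x - h) ∂μ = ∫ h, (w x - w (x - h)) ∂μ := fun x => by
    rw [integral_sub (integrable_const _) (hμ x)]; simp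
  have i : ∀ x, Integrable (fun h => w x - w (x - h)) μ :=
    fun x => (integrable_const _).sub (hμ x)
  unfold sobolevEnergy
  simp only [e]
  rw [lintegral_add_left' (by
    refine Measurable.aemeasurable ?_
    refine Measurable.lintegral_prod_right'
      (f := fun p : E n × E n => ‖w p.2 - w (p.2 - p.1)‖ₑ ^ 2) ?_
    fun_prop)]
  refine add_le_add ?_ ?_
  · rw [lintegral_lintegral_swap (by fun_prop)]
    exact lintegral_mono fun x => enorm_integral_sq_le (i x).1
  · rw [lintegral_lintegral_swap (by fun_prop)]
    refine lintegral_mono fun z => ?_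
    rw [lintegral_mul_const _ (by fun_prop)]
    gcongr
    rw [← integral_sub (i _) (i _)]
    exact enorm_integral_sq_le ((i z.1).sub (i z.2)).1

/-- A single convolution, with a bump centred at `t` instead of `0`, both shifts `w` into `Ω` and
smooths it. The error is at most the average of the translation errors over the support of the bump.
-/
lemma memHsTilde_of_translate {s : ℝ} {Ω : Set (E n)} (hΩ : IsOpen Ω) {w : E n → ℝ}
    (hw : Measurable w) (hw' : sobolevEnergy s w < ⊤) {K : Set (E n)} (hK : IsCompact K)
    (hwK : ∀ x, x ∉ K → w x = 0)
    (htr : ∀ η : ℝ, 0 < η → ∃ h : E n, ‖h‖ < η ∧ ∀ x ∈ K, h + x ∈ Ω)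
    (ε : ℝ≥0∞) (hε : 0 < ε) :
    ∃ φ : E n → ℝ, IsTestFunction Ω φ ∧ sobolevEnergy s (fun x => w x - φ x) ≤ ε := by
  have hev := (tendsto_sobolevEnergy_sub_translate hw hw').eventually (ge_mem_nhds hε)
  obtain ⟨δ, hδ, hball⟩ := Metric.eventually_nhds_iff.1 hev
  obtain ⟨t, ht, htK⟩ := htr (δ / 2) (by positivity)
  have hKt : IsCompact ({t} + K) := isCompact_singleton.add hK
  obtain ⟨ρ, hρ, hρΩ⟩ := hKt.exists_cthickening_subset_open hΩ (by
    rintro _ ⟨a, rfl, b, hb, rfl⟩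
    exact htK b hb)
  have hr : 0 < min (ρ) (δ / 2) := by positivity
  -- Radius at most `ρ` keeps the support in `Ω`; radius at most `δ / 2`, with `‖t‖ < δ / 2`, makes
  -- every translation vector shorter than `δ`.
  let β : ContDiffBump t := ⟨min ρ (δ / 2) / 2, min ρ (δ / 2), by positivity, by linarith⟩
  set φ : E n → ℝ := β.normed volume with hφ
  have hφc : Continuous φ := β.continuous_normed
  have hφs : tsupport φ = Metric.closedBall t (min ρ (δ / 2)) := β.tsupport_normed_eq
  have hφK : HasCompactSupport φ := β.hasCompactSupport_normed
  have hφ0 : ∀ x, 0 ≤ φ x := fun x => β.nonneg_normed x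
  have hφi : ∫ x, φ x = 1 := β.integral_normed
  set μ : Measure (E n) := volume.withDensity fun h => ENNReal.ofReal (φ h) with hμ
  have : IsProbabilityMeasure μ := by
    refine ⟨?_⟩
    rw [hμ, withDensity_apply _ MeasurableSet.univ, setLIntegral_univ,
      ← ofReal_integral_eq_lintegral_ofReal (hφc.integrable_of_hasCompactSupport hφK)
        (Eventually.of_forall hφ0), hφi, ENNReal.ofReal_one]
  have hL2 : MemLp w 2 volume :=
    memLp_two_of_sobolevEnergy_lt_top hw.aestronglyMeasurable hw'
  have hloc : LocallyIntegrable w volume := hL2.locallyIntegrable (by norm_num)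
  have hint : ∀ x, Integrable (fun h => w (x - h)) μ := by
    intro x
    rw [hμ, integrable_withDensity_iff_integrable_smul' (by fun_prop) (by simp)]
    have := hφK.convolutionExists_left (ContinuousLinearMap.lsmul ℝ ℝ) hφc hloc x
    refine Integrable.congr this (Eventually.of_forall fun h => ?_)
    simp [ENNReal.toReal_ofReal (hφ0 h)]
  have hconv : ∀ x, ∫ h, w (x - h) ∂μ = (φ ⋆[ContinuousLinearMap.lsmul ℝ ℝ, volume] w) x := by
    intro x
    rw [hμ, integral_withDensity_eq_integral_toReal_smul (by fun_prop) (by simp), convolution]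
    refine integral_congr_ae (Eventually.of_forall fun h => ?_)
    simp [ENNReal.toReal_ofReal (hφ0 h)]
  have hsub : tsupport (φ ⋆[ContinuousLinearMap.lsmul ℝ ℝ, volume] w) ⊆
      Metric.cthickening ρ ({t} + K) := by
    refine closure_minimal ((support_convolution_subset _).trans ?_) Metric.isClosed_cthickening
    rintro _ ⟨a, ha, b, hb, rfl⟩
    have ha' : a ∈ Metric.closedBall t (min ρ (δ / 2)) := hφs ▸ subset_tsupport _ ha
    have hb' : b ∈ K := by
      by_contra hc
      exact hb (hwK b hc)
    refine Metric.mem_cthickening_of_dist_le _ (t + b) _ _ ⟨t, rfl, b, hb', rfl⟩ ?_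
    simp only [dist_add_right]
    exact (Metric.mem_closedBall.1 ha').trans (min_le_left _ _)
  refine ⟨φ ⋆[ContinuousLinearMap.lsmul ℝ ℝ, volume] w, ⟨?_, ?_, hsub.trans hρΩ⟩, ?_⟩
  · exact hφK.contDiff_convolution_left _ (β.contDiff_normed) hloc
  · exact hKt.cthickening.of_isClosed_subset (isClosed_tsupport _) hsub
  · simp only [← hconv]
    refine (sobolevEnergy_sub_average_le hw μ hint).trans ?_
    calc _ ≤ ∫⁻ _, ε ∂μ := by
          refine lintegral_mono_ae ?_
          rw [hμ, ae_withDensity_iff (by fun_prop)]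
          refine Eventually.of_forall fun h hh => hball ?_
          have hs : h ∈ tsupport φ := subset_tsupport _ fun h0 => hh (by simp [h0])
          rw [hφs, Metric.mem_closedBall] at hs
          rw [dist_zero_right]
          calc ‖h‖ ≤ ‖h - t‖ + ‖t‖ := by simpa using norm_add_le (h - t) t
            _ < δ / 2 + δ / 2 := add_lt_add_of_le_of_lt
              (by rw [← dist_eq_norm]; exact hs.trans (min_le_right _ _)) ht
            _ = δ := by ring
      _ = ε := by simp


/-! ### Multiplication by cutoffs -/

/-- Near the origin the integrand is at most `|h|^{2-n-2s}`, integrable since `s < 1`; at infinity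
it is at most `|h|^{-n-2s}`, integrable since `0 < s`. -/
lemma lintegral_min_mul_singularWeight_lt_top (hn : 0 < n) {s : ℝ} (hs : 0 < s) (hs' : s < 1) :
    ∫⁻ h : E n, ENNReal.ofReal (min 1 (‖h‖ ^ 2)) * singularWeight s h < ⊤ := by
  set F : E n → ℝ := fun h => min 1 (‖h‖ ^ 2) * (‖h‖ ^ ((n : ℝ) + 2 * s))⁻¹ with hF
  have hF0 : ∀ h, 0 ≤ F h := fun h => by positivity
  have hFm : Measurable F := by fun_prop
  have hfin : Module.finrank ℝ (E n) = n := finrank_euclideanSpace_fin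
  suffices hint : Integrable F volume by
    have := hint.lintegral_lt_top
    refine lt_of_le_of_lt (le_of_eq ?_) this
    refine lintegral_congr fun h => ?_
    rw [singularWeight, ← ENNReal.ofReal_mul (by positivity)]
  rw [← integrableOn_univ, ← Set.union_compl_self (Metric.ball (0 : E n) 1)]
  refine IntegrableOn.union ?_ ?_
  · refine integrableOn_ball_of_norm_le_rpow (C := 1) (α := n + 2 * s - 2) (by omega)
      (by rw [hfin]; linarith) (Eventually.of_forall fun h => ?_) hFm.aestronglyMeasurable
    rw [Real.norm_of_nonneg (hF0 h), one_mul]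
    rcases eq_or_ne h 0 with rfl | hh
    · simp only [hF, norm_zero]
      norm_num
      positivity
    · have hp : 0 < ‖h‖ := norm_pos_iff.2 hh
      calc F h ≤ ‖h‖ ^ 2 * (‖h‖ ^ ((n : ℝ) + 2 * s))⁻¹ := by
            simp only [hF]; gcongr; exact min_le_right _ _
        _ = ‖h‖ ^ (-((n : ℝ) + 2 * s - 2)) := by
            rw [← Real.rpow_neg hp.le, ← Real.rpow_natCast, ← Real.rpow_add hp]
            congr 1
            push_cast
            ring
  · have hi : Integrable
        (fun h : E n => 2 ^ ((n : ℝ) + 2 * s) * (1 + ‖h‖) ^ (-((n : ℝ) + 2 * s))) :=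
      (integrable_one_add_norm (by rw [hfin]; linarith)).const_mul _
    refine Integrable.mono' hi.integrableOn hFm.aestronglyMeasurable.restrict ?_
    refine (ae_restrict_iff' Metric.isOpen_ball.measurableSet.compl).2
      (Eventually.of_forall fun h hh => ?_)
    have h1 : 1 ≤ ‖h‖ := by simpa using hh
    rw [Real.norm_of_nonneg (hF0 h)]
    calc F h ≤ 1 * (‖h‖ ^ ((n : ℝ) + 2 * s))⁻¹ := by
          simp only [hF]; gcongr; exact min_le_left _ _
      _ ≤ (((1 + ‖h‖) / 2) ^ ((n : ℝ) + 2 * s))⁻¹ := by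
          rw [one_mul]
          gcongr
          linarith
      _ = _ := by
          rw [Real.div_rpow (by positivity) (by norm_num), Real.rpow_neg (by positivity)]
          field_simp

/-- Multiplication by a bounded Lipschitz function preserves `H^s`. -/
lemma sobolevEnergy_mul_lt_top (hn : 0 < n) {s : ℝ} (hs : 0 < s) (hs' : s < 1)
    {χ w : E n → ℝ} {L : ℝ≥0} (hχ : LipschitzWith L χ) {B : ℝ} (hB : ∀ x, |χ x| ≤ B)
    (hw : Measurable w) (hw' : sobolevEnergy s w < ⊤) :
    sobolevEnergy s (fun x => χ x * w x) < ⊤ := by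
  have hχm : Measurable χ := hχ.continuous.measurable
  have hB0 : 0 ≤ B := (abs_nonneg _).trans (hB 0)
  have hχe : ∀ x, ‖χ x‖ₑ ≤ ENNReal.ofReal B := fun x => by
    rw [← ofReal_norm]; exact ENNReal.ofReal_le_ofReal (hB x)
  obtain ⟨w2, wG⟩ := ENNReal.add_lt_top.1 hw'
  -- The constant `2 * B + L` dominates both the sup bound, used at distance at least `1`, and the
  -- Lipschitz bound, used below it.
  have hbound : ∀ x y, ‖χ x - χ y‖ₑ ^ 2 ≤
      ENNReal.ofReal ((2 * B + L) ^ 2) * ENNReal.ofReal (min 1 (‖x - y‖ ^ 2)) := fun x y => by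
    rw [← ofReal_norm, ← ENNReal.ofReal_pow (norm_nonneg _), ← ENNReal.ofReal_mul (by positivity)]
    refine ENNReal.ofReal_le_ofReal ?_
    have h1 : ‖χ x - χ y‖ ≤ 2 * B := by
      refine (norm_sub_le _ _).trans ?_
      have := hB x
      have := hB y
      simp only [Real.norm_eq_abs]
      linarith
    have h2 : ‖χ x - χ y‖ ≤ L * ‖x - y‖ := by
      simpa [dist_eq_norm] using hχ.dist_le_mul x y
    rcases le_total 1 (‖x - y‖ ^ 2) with h | h
    · rw [min_eq_left h, mul_one]
      gcongr
      linarith [L.coe_nonneg]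
    · rw [min_eq_right h, ← mul_pow]
      gcongr
      refine h2.trans ?_
      gcongr
      linarith
  refine ENNReal.add_lt_top.2 ⟨?_, ?_⟩
  · calc ∫⁻ x, ‖χ x * w x‖ₑ ^ 2 ≤ ∫⁻ x, ENNReal.ofReal B ^ 2 * ‖w x‖ₑ ^ 2 := by
          refine lintegral_mono fun x => ?_
          rw [enorm_mul, mul_pow]
          gcongr
          exact hχe x
      _ < ⊤ := by
          rw [lintegral_const_mul' _ _ (by simp)]
          exact ENNReal.mul_lt_top (by simp) w2
  · have key := lintegral_mul_enorm_add_sq_le (μ := (volume : Measure (E n × E n)))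
      (a := fun z => χ z.1 * (w z.1 - w z.2)) (b := fun z => (χ z.1 - χ z.2) * w z.2)
      (k := fun z => singularWeight s (z.1 - z.2)) (by fun_prop) (by fun_prop)
    -- In this product rule the first term is controlled by the energy of `w`, the second by
    -- `hbound` after integrating in the first variable with the second fixed.
    have e : ∀ z : E n × E n, χ z.1 * w z.1 - χ z.2 * w z.2 =
        χ z.1 * (w z.1 - w z.2) + (χ z.1 - χ z.2) * w z.2 := fun z => by ring
    simp only [e]
    refine key.trans_lt (ENNReal.add_lt_top.2
      ⟨ENNReal.mul_lt_top (by simp) ?_, ENNReal.mul_lt_top (by simp) ?_⟩)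
    · calc _ ≤ ∫⁻ z : E n × E n, ENNReal.ofReal B ^ 2 *
              (‖w z.1 - w z.2‖ₑ ^ 2 * singularWeight s (z.1 - z.2)) := by
            refine lintegral_mono fun z => ?_
            rw [enorm_mul, mul_pow, mul_assoc]
            gcongr
            exact hχe _
        _ < ⊤ := by
            rw [lintegral_const_mul' _ _ (by simp)]
            exact ENNReal.mul_lt_top (by simp) wG
    · calc _ ≤ ∫⁻ z : E n × E n, ENNReal.ofReal ((2 * B + L) ^ 2) *
              (‖w z.2‖ₑ ^ 2 * (ENNReal.ofReal (min 1 (‖z.1 - z.2‖ ^ 2)) *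
                singularWeight s (z.1 - z.2))) := by
            refine lintegral_mono fun z => ?_
            rw [enorm_mul, mul_pow]
            calc _ ≤ (ENNReal.ofReal ((2 * B + L) ^ 2) * ENNReal.ofReal (min 1 (‖z.1 - z.2‖ ^ 2)))
                  * ‖w z.2‖ₑ ^ 2 * singularWeight s (z.1 - z.2) := by
                  gcongr; exact hbound _ _
              _ = _ := by ring
        _ < ⊤ := by
            rw [lintegral_const_mul' _ _ (by simp)]
            refine ENNReal.mul_lt_top (by simp) ?_
            rw [Measure.volume_eq_prod, lintegral_prod_symm' _ (by fun_prop)]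
            simp only
            calc _ = ∫⁻ y : E n, ‖w y‖ₑ ^ 2 * ∫⁻ h : E n, ENNReal.ofReal (min 1 (‖h‖ ^ 2)) *
                  singularWeight s h := by
                  refine lintegral_congr fun y => ?_
                  rw [lintegral_const_mul' _ _ (by simp)]
                  congr 1
                  exact lintegral_sub_right_eq_self
                    (fun h : E n => ENNReal.ofReal (min 1 (‖h‖ ^ 2)) * singularWeight s h) y
              _ < ⊤ := by
                  rw [lintegral_mul_const _ (by fun_prop)]
                  exact ENNReal.mul_lt_top w2 (lintegral_min_mul_singularWeight_lt_top hn hs hs')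

/-! ### Geometry of the boundary -/

lemma orthogonalProjectionOnto_add_smul_self (ν x : E n) (t : ℝ) :
    (ℝ ∙ ν)ᗮ.orthogonalProjectionOnto (t • ν + x) = (ℝ ∙ ν)ᗮ.orthogonalProjectionOnto x := by
  have : (ℝ ∙ ν)ᗮ.orthogonalProjectionOnto ν = 0 := by
    rw [Submodule.orthogonalProjectionOnto_eq_zero_iff]
    exact Submodule.le_orthogonal_orthogonal _ (Submodule.mem_span_singleton_self ν)
  simp [this]

lemma inner_smul_add_self {ν : E n} (hν : ‖ν‖ = 1) (x : E n) (t : ℝ) :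
    inner ℝ ν (t • ν + x) = t + inner ℝ ν x := by
  simp [inner_add_right, inner_smul_right, hν]

lemma IsC11GraphNear.le_of_mem_closure {Ω : Set (E n)} {p : E n} {ρ : ℝ} {ν : E n}
    {γ : (ℝ ∙ ν)ᗮ → ℝ} (h : IsC11GraphNear Ω p ρ ν γ) {x : E n} (hx : x ∈ Metric.ball p ρ)
    (hx' : x ∈ closure Ω) : γ ((ℝ ∙ ν)ᗮ.orthogonalProjectionOnto x) ≤ inner ℝ ν x := by
  have hγ : Continuous γ := h.2.1.continuous
  by_contra! hlt
  have hopen : IsOpen (Metric.ball p ρ ∩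
      {y | inner ℝ ν y < γ ((ℝ ∙ ν)ᗮ.orthogonalProjectionOnto y)}) :=
    Metric.isOpen_ball.inter (isOpen_lt (by fun_prop) (by fun_prop))
  obtain ⟨y, ⟨hy, hy'⟩, hyΩ⟩ := mem_closure_iff.1 hx' _ hopen ⟨hx, hlt⟩
  exact lt_asymm hy' ((h.2.2.2 y hy).1 hyΩ)

/-- Vertical translates of a graph by distinct heights are disjoint. Infinitely many of them with
bounded translation vectors force measure zero; the heights `1 / (k + 1)` serve. -/
lemma IsC11GraphNear.volume_graph_eq_zero {Ω : Set (E n)} {p : E n} {ρ : ℝ} {ν : E n}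
    {γ : (ℝ ∙ ν)ᗮ → ℝ} (h : IsC11GraphNear Ω p ρ ν γ) :
    volume {x : E n | inner ℝ ν x = γ ((ℝ ∙ ν)ᗮ.orthogonalProjectionOnto x)} = 0 := by
  have hγ : Continuous γ := h.2.1.continuous
  refine Measure.addHaar_eq_zero_of_disjoint_translates volume
    (fun k : ℕ => ((1 : ℝ) / (k + 1)) • ν) ?_ ?_ ?_
  · refine (Metric.isBounded_closedBall (x := (0 : E n)) (r := 1)).subset ?_
    rintro _ ⟨k, rfl⟩
    rw [mem_closedBall_zero_iff, norm_smul, h.1, mul_one, Real.norm_of_nonneg (by positivity)]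
    rw [div_le_one (by positivity)]
    linarith [(Nat.cast_nonneg k : (0 : ℝ) ≤ k)]
  · intro k l hkl
    rw [Function.onFun, Set.disjoint_left]
    rintro _ ⟨_, rfl, a, ha, rfl⟩ ⟨_, rfl, b, hb, hab⟩
    simp only at hab
    have h1 := congrArg (fun x => (ℝ ∙ ν)ᗮ.orthogonalProjectionOnto x) hab
    have h2 := congrArg (fun x => inner ℝ ν x) hab
    simp only [orthogonalProjectionOnto_add_smul_self] at h1
    simp only [inner_smul_add_self h.1] at h2
    rw [Set.mem_ofPred_eq] at ha hb
    rw [ha, hb, h1] at h2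
    have h3 : (1 : ℝ) / (l + 1) = 1 / (k + 1) := by linarith
    rw [div_eq_div_iff (by positivity) (by positivity)] at h3
    refine hkl ?_
    have : (k : ℝ) = l := by linarith
    exact_mod_cast this
  · exact (isClosed_eq (by fun_prop) (by fun_prop)).measurableSet

/-- Inside a chart ball the frontier lies on the graph: closure points are not below it, and points
outside `Ω` are not above it. -/
lemma IsBoundedC11Domain.volume_frontier {Ω : Set (E n)} (hΩ : IsBoundedC11Domain Ω) :
    volume (frontier Ω) = 0 := by
  refine measure_null_of_locally_null _ fun p hp => ?_
  obtain ⟨ρ, ν, γ, hρ, h⟩ := hΩ.boundary p hp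
  refine ⟨Metric.ball p ρ ∩ frontier Ω, ?_, measure_mono_null ?_ h.volume_graph_eq_zero⟩
  · exact Filter.inter_mem (mem_nhdsWithin_of_mem_nhds (Metric.ball_mem_nhds p hρ))
      self_mem_nhdsWithin
  · rintro x ⟨hx, hxf⟩
    refine le_antisymm ?_ (h.le_of_mem_closure hx hxf.1)
    have : x ∉ Ω := by
      rw [hΩ.isOpen.frontier_eq] at hxf
      exact hxf.2
    exact not_lt.1 fun hlt => this ((h.2.2.2 x hx).2 hlt)

/-- Near every point of its closure, a `C^{1,1}` domain contains small translates of the compact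
subsets of its closure. -/
lemma IsBoundedC11Domain.exists_nhds_translate {Ω : Set (E n)} (hΩ : IsBoundedC11Domain Ω)
    {p : E n} (hp : p ∈ closure Ω) :
    ∃ U : Set (E n), IsOpen U ∧ Bornology.IsBounded U ∧ p ∈ U ∧
      ∀ K : Set (E n), IsCompact K → K ⊆ U → K ⊆ closure Ω →
        ∀ η : ℝ, 0 < η → ∃ h : E n, ‖h‖ < η ∧ ∀ x ∈ K, h + x ∈ Ω := by
  by_cases hpΩ : p ∈ Ω
  · exact ⟨Ω, hΩ.isOpen, hΩ.isBounded, hpΩ, fun K _ hKU _ η hη =>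
      ⟨0, by simpa using hη, fun x hx => by simpa using hKU hx⟩⟩
  · obtain ⟨ρ, ν, γ, hρ, h⟩ := hΩ.boundary p (by rw [hΩ.isOpen.frontier_eq]; exact ⟨hp, hpΩ⟩)
    refine ⟨Metric.ball p ρ, Metric.isOpen_ball, Metric.isBounded_ball, Metric.mem_ball_self hρ,
      fun K hK hKU hKΩ η hη => ?_⟩
    obtain ⟨δ, hδ, hδK⟩ := hK.exists_cthickening_subset_open Metric.isOpen_ball hKU
    have ht : 0 < min δ (η / 2) := by positivity
    have hnorm : ‖min δ (η / 2) • ν‖ = min δ (η / 2) := by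
      rw [norm_smul, h.1, mul_one, Real.norm_of_nonneg ht.le]
    -- Moving up along `ν` keeps the projection and raises the height, so a weak inequality at
    -- points of the closure becomes strict; `δ` keeps the moved points in the chart ball.
    refine ⟨min δ (η / 2) • ν, ?_, fun x hx => ?_⟩
    · rw [hnorm]
      exact (min_le_right _ _).trans_lt (by linarith)
    · have hmem : min δ (η / 2) • ν + x ∈ Metric.ball p ρ := by
        refine hδK (Metric.mem_cthickening_of_dist_le _ x _ _ hx ?_)
        rw [dist_eq_norm, add_sub_cancel_right, hnorm]
        exact min_le_left _ _
      rw [h.2.2.2 _ hmem, orthogonalProjectionOnto_add_smul_self, inner_smul_add_self h.1]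
      linarith [h.le_of_mem_closure (hKU hx) (hKΩ hx)]


/-! ### Approximation by test functions -/

lemma IsTestFunction.zero (Ω : Set (E n)) : IsTestFunction Ω (fun _ => 0) :=
  ⟨contDiff_const, HasCompactSupport.zero, by
    rw [show tsupport (fun _ : E n => (0 : ℝ)) = ∅ from tsupport_eq_empty_iff.2 rfl]
    exact Set.empty_subset _⟩

lemma IsTestFunction.add {Ω : Set (E n)} {φ ψ : E n → ℝ} (hφ : IsTestFunction Ω φ)
    (hψ : IsTestFunction Ω ψ) : IsTestFunction Ω (fun x => φ x + ψ x) :=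
  ⟨hφ.contDiff.add hψ.contDiff, hφ.hasCompactSupport.add hψ.hasCompactSupport,
    (tsupport_add φ ψ).trans (Set.union_subset hφ.tsupport_subset hψ.tsupport_subset)⟩

/-- Finite sums of functions that can be approximated by test functions can be so, too. -/
lemma exists_testFunction_sum {s : ℝ} {Ω : Set (E n)} {ι : Type*} (I : Finset ι)
    {w : ι → E n → ℝ} (hw : ∀ i, Measurable (w i))
    (h : ∀ i, ∀ ε : ℝ≥0∞, 0 < ε → ∃ φ : E n → ℝ, IsTestFunction Ω φ ∧
      sobolevEnergy s (fun x => w i x - φ x) ≤ ε) :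
    ∀ ε : ℝ≥0∞, 0 < ε → ∃ φ : E n → ℝ, IsTestFunction Ω φ ∧
      sobolevEnergy s (fun x => (∑ i ∈ I, w i x) - φ x) ≤ ε := by
  classical
  induction I using Finset.induction_on with
  | empty => exact fun ε _ => ⟨_, IsTestFunction.zero Ω, by simp [sobolevEnergy]⟩
  | insert i I hi ih =>
    intro ε hε
    -- The quarter offsets the factors `2` in `sobolevEnergy_add_le`.
    have hε' : 0 < ε / 4 := ENNReal.div_pos hε.ne' (by simp)
    obtain ⟨φ, hφ, hφ'⟩ := h i _ hε'
    obtain ⟨ψ, hψ, hψ'⟩ := ih _ hε'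
    refine ⟨_, hφ.add hψ, ?_⟩
    have e : ∀ x, (∑ j ∈ insert i I, w j x) - (φ x + ψ x) =
        (w i x - φ x) + ((∑ j ∈ I, w j x) - ψ x) := fun x => by
      rw [Finset.sum_insert hi]; ring
    simp only [e]
    calc _ ≤ 2 * (ε / 4) + 2 * (ε / 4) :=
          (sobolevEnergy_add_le ((hw i).sub hφ.contDiff.continuous.measurable).aemeasurable).trans
            (by gcongr; exact hφ')
      _ = ε := by
          rw [← two_mul, ← mul_assoc, show (2 : ℝ≥0∞) * 2 = 4 by norm_num]
          exact ENNReal.mul_div_cancel (by simp) (by simp)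

/-- On a bounded `C^{1,1}` domain, the functions in `H^s(ℝⁿ)` that vanish almost everywhere outside
the domain belong to the closure of the test functions. -/
theorem memHsTilde_of_ae_eq_zero (hn : 0 < n) {s : ℝ} (hs : 0 < s) (hs' : s < 1) {Ω : Set (E n)}
    (hΩ : IsBoundedC11Domain Ω) {v : E n → ℝ} (hv : MemHs s v)
    (hv0 : ∀ᵐ x, x ∉ Ω → v x = 0) : MemHsTilde s Ω v := by
  refine memHsTilde_of_energy hv fun ε hε => ?_
  obtain ⟨hvm, hvE⟩ := memHs_iff.1 hv
  -- A measurable representative that vanishes everywhere, not just a.e., off the closure, as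
  -- pointwise support conditions are needed below.
  set v' : E n → ℝ := (closure Ω).indicator (hvm.mk v) with hv'
  have hv'm : Measurable v' :=
    hvm.stronglyMeasurable_mk.measurable.indicator isClosed_closure.measurableSet
  have hvv' : v =ᵐ[volume] v' := by
    filter_upwards [hvm.ae_eq_mk, hv0] with x hx hx0
    by_cases hxc : x ∈ closure Ω
    · rw [hv', Set.indicator_of_mem hxc, hx]
    · rw [hv', Set.indicator_of_notMem hxc, hx0 fun h => hxc (subset_closure h)]
  have hv'E : sobolevEnergy s v' < ⊤ := by rwa [← sobolevEnergy_congr_ae hvv']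
  have hcomp : IsCompact (closure Ω) := hΩ.isBounded.isCompact_closure
  choose! U hUo hUb hpU hUt using fun p (hp : p ∈ closure Ω) => hΩ.exists_nhds_translate hp
  obtain ⟨t, ht, htc⟩ := hcomp.elim_nhds_subcover U fun p hp => (hUo p hp).mem_nhds (hpU p hp)
  obtain ⟨χ, hχ⟩ := SmoothPartitionOfUnity.exists_isSubordinate (modelWithCornersSelf ℝ (E n))
    (s := closure Ω) isClosed_closure (fun p : t => U p) (fun p => hUo p (ht p p.2))
    (by simpa [Set.iUnion_subtype] using htc)
  have hsum : ∀ x, ∑ i, χ i x * v' x = v' x := by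
    intro x
    rw [← Finset.sum_mul]
    by_cases hx : x ∈ closure Ω
    · have := χ.sum_eq_one hx
      rw [finsum_eq_sum_of_fintype] at this
      rw [this, one_mul]
    · rw [hv', Set.indicator_of_notMem hx, mul_zero]
  have happ : ∀ i, ∀ ε : ℝ≥0∞, 0 < ε → ∃ φ : E n → ℝ, IsTestFunction Ω φ ∧
      sobolevEnergy s (fun x => χ i x * v' x - φ x) ≤ ε := by
    intro i
    have hi := ht i i.2
    have hcs : HasCompactSupport (χ i) :=
      Metric.isCompact_of_isClosed_isBounded (isClosed_tsupport _) ((hUb i hi).subset (hχ i))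
    have hcd : ContDiff ℝ ∞ (χ i) := (χ i).contMDiff.contDiff
    obtain ⟨L, hL⟩ := hcd.lipschitzWith_of_hasCompactSupport hcs (by simp)
    refine memHsTilde_of_translate hΩ.isOpen (K := tsupport (χ i) ∩ closure Ω)
      ((χ i).contMDiff.continuous.measurable.mul hv'm)
      (sobolevEnergy_mul_lt_top hn hs hs' hL (B := 1) (fun x => ?_) hv'm hv'E)
      (hcomp.inter_left (isClosed_tsupport _)) (fun x hx => ?_)
      (hUt i hi _ (hcomp.inter_left (isClosed_tsupport _)) (Set.inter_subset_left.trans (hχ i))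
        Set.inter_subset_right)
    · rw [abs_of_nonneg (χ.nonneg i x)]
      exact χ.le_one i x
    · by_cases hxc : x ∈ closure Ω
      · rw [image_eq_zero_of_notMem_tsupport fun h => hx ⟨h, hxc⟩, zero_mul]
      · rw [hv', Set.indicator_of_notMem hxc, mul_zero]
  obtain ⟨ε', hε', hεε'⟩ := exists_between hε
  obtain ⟨φ, hφ, hφE⟩ := exists_testFunction_sum Finset.univ (w := fun i x => χ i x * v' x)
    (fun i => (χ i).contMDiff.continuous.measurable.mul hv'm) happ ε' hε'
  refine ⟨φ, hφ, lt_of_le_of_lt ?_ hεε'⟩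
  simp only [hsum] at hφE
  rwa [sobolevEnergy_congr_ae (v := fun x => v' x - φ x)]
  filter_upwards [hvv'] with x hx
  rw [hx]

/-! ### Sign of the magnetic form -/

/-- Allows a.e. hypotheses on `A` to be used at the midpoint of almost every pair. -/
lemma quasiMeasurePreserving_midpoint :
    Measure.QuasiMeasurePreserving (fun z : E n × E n => (1 / 2 : ℝ) • (z.1 + z.2))
      volume volume := by
  have h := (measurePreserving_prod_add (volume : Measure (E n))
    (volume : Measure (E n))).quasiMeasurePreserving
  exact (Measure.quasiMeasurePreserving_smul volume (by norm_num : (1 / 2 : ℝ) ≠ 0)).comp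
    (Measure.quasiMeasurePreserving_snd.comp h)

lemma norm_le_of_abs_coord_le (hn : 0 < n) {r : ℝ} (hr : 0 < r) {a : E n}
    (ha : ∀ j, |a j| ≤ Real.pi / (8 * √n * r)) : ‖a‖ ≤ Real.pi / (8 * r) := by
  have hn' : 0 < √(n : ℝ) := Real.sqrt_pos.2 (by exact_mod_cast hn)
  have hpi := Real.pi_pos
  rw [EuclideanSpace.norm_eq]
  refine Real.sqrt_le_iff.2 ⟨by positivity, ?_⟩
  calc ∑ j, ‖a j‖ ^ 2 ≤ ∑ _j : Fin n, (Real.pi / (8 * √n * r)) ^ 2 := by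
        gcongr with j
        exact ha j
    _ = n * (Real.pi / (8 * √n * r)) ^ 2 := by simp
    _ = (Real.pi / (8 * r)) ^ 2 := by
        have hsq : √(n : ℝ) ^ 2 = n := Real.sq_sqrt (by positivity)
        nth_rewrite 1 [← hsq]
        field_simp

/-- For a potential that is small and supported in `B_r(0)`, the cosine of the phase is nonnegative
as soon as one of the two points lies in `B_r(0)`. -/
lemma ae_cos_phase_nonneg (hn : 0 < n) {r : ℝ} (hr : 0 < r) {A : E n → E n}
    (hA0 : ∀ᵐ x, x ∉ Metric.ball (0 : E n) r → A x = 0)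
    (hA : ∀ᵐ x, ∀ j : Fin n, |A x j| ≤ Real.pi / (8 * √n * r)) :
    ∀ᵐ z : E n × E n, (z.1 ∈ Metric.ball 0 r ∨ z.2 ∈ Metric.ball 0 r) →
      0 ≤ Real.cos (phase A z.1 z.2) := by
  filter_upwards [quasiMeasurePreserving_midpoint.ae hA0, quasiMeasurePreserving_midpoint.ae hA]
    with ⟨x, y⟩ h0 hb hxy
  simp only at h0 hb hxy
  set m : E n := (1 / 2 : ℝ) • (x + y) with hm
  by_cases hmr : m ∈ Metric.ball 0 r
  · rw [mem_ball_zero_iff] at hmr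
    -- The distance from `x` to `y` is twice that from either point to the midpoint; `4 * r` times
    -- `π / (8 * r)` is exactly `π / 2`.
    have hd : ‖x - y‖ ≤ 4 * r := by
      rcases hxy with h | h <;> rw [mem_ball_zero_iff] at h
      · have : x - y = (2 : ℝ) • (x - m) := by rw [hm]; module
        rw [this, norm_smul, Real.norm_of_nonneg (by norm_num)]
        linarith [norm_sub_le x m]
      · have : x - y = (2 : ℝ) • (m - y) := by rw [hm]; module
        rw [this, norm_smul, Real.norm_of_nonneg (by norm_num)]
        linarith [norm_sub_le m y]
    have hphase : |phase A x y| ≤ Real.pi / 2 := by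
      calc |phase A x y| ≤ ‖x - y‖ * ‖A m‖ := abs_real_inner_le_norm _ _
        _ ≤ (4 * r) * (Real.pi / (8 * r)) := by
            gcongr
            exact norm_le_of_abs_coord_le hn hr hb
        _ = Real.pi / 2 := by field_simp; norm_num
    exact Real.cos_nonneg_of_mem_Icc (abs_le.1 hphase)
  · have : phase A x y = 0 := by
      rw [phase, ← hm, h0 hmr, inner_zero_right]
    simp [this]

lemma kernelConst_nonneg (n : ℕ) {s : ℝ} (hs : 0 < s) : 0 ≤ kernelConst n s := by
  have := Real.pi_pos
  have : 0 ≤ Real.Gamma ((n : ℝ) / 2 + s) := (Real.Gamma_pos_of_pos (by positivity)).le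
  unfold kernelConst
  positivity

lemma integrand_re (θ a b c d k : ℝ) :
    ((((a : ℂ) - Complex.exp (Complex.I * (θ : ℂ)) * (b : ℂ)) *
      ((c : ℂ) - Complex.exp (-(Complex.I * (θ : ℂ))) * (d : ℂ)) * (k : ℂ))).re =
    (a * c + b * d - Real.cos θ * (a * d + b * c)) * k := by
  have h1 : Complex.exp (Complex.I * (θ : ℂ)) = Real.cos θ + Real.sin θ * Complex.I := by
    rw [mul_comm, Complex.exp_mul_I, Complex.ofReal_cos, Complex.ofReal_sin]
  have h2 : Complex.exp (-(Complex.I * (θ : ℂ))) = Real.cos θ - Real.sin θ * Complex.I := by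
    rw [show -(Complex.I * (θ : ℂ)) = ((-θ : ℝ) : ℂ) * Complex.I by push_cast; ring,
      Complex.exp_mul_I, ← Complex.ofReal_cos, ← Complex.ofReal_sin, Real.cos_neg, Real.sin_neg]
    push_cast; ring
  rw [Complex.re_mul_ofReal, h1, h2]
  congr 1
  simp only [Complex.mul_re, Complex.sub_re, Complex.sub_im, Complex.add_re, Complex.add_im,
    Complex.mul_im, Complex.ofReal_re, Complex.ofReal_im, Complex.I_re, Complex.I_im]
  linear_combination b * d * Real.sin_sq_add_cos_sq θ

/-- With `p = (a - M)⁺` and `p' = (b - M)⁺` the expression equals `(1 - γ)(a p + b p') + γ (a - b)(p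
- p')`. The first bracket is nonnegative because `0 ≤ M`, the last product because truncation is
monotone. -/
lemma integrand_nonneg {γ a b M : ℝ} (hγ : 0 ≤ γ) (hγ' : γ ≤ 1) (hM : 0 ≤ M) :
    0 ≤ a * max (a - M) 0 + b * max (b - M) 0 - γ * (a * max (b - M) 0 + b * max (a - M) 0) := by
  rcases le_total (a - M) 0 with ha | ha <;> rcases le_total (b - M) 0 with hb | hb
  · simp [max_eq_right ha, max_eq_right hb]
  · rw [max_eq_right ha, max_eq_left hb]
    nlinarith [mul_nonneg (sub_nonneg.2 hγ') (mul_nonneg hM hb),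
      mul_nonneg hγ (mul_nonneg hb (by linarith : 0 ≤ b - a)),
      mul_nonneg (sub_nonneg.2 hγ') (mul_nonneg hb hb)]
  · rw [max_eq_left ha, max_eq_right hb]
    nlinarith [mul_nonneg (sub_nonneg.2 hγ') (mul_nonneg hM ha),
      mul_nonneg hγ (mul_nonneg ha (by linarith : 0 ≤ a - b)),
      mul_nonneg (sub_nonneg.2 hγ') (mul_nonneg ha ha)]
  · rw [max_eq_left ha, max_eq_left hb]
    nlinarith [mul_nonneg (sub_nonneg.2 hγ') (mul_nonneg hM ha),
      mul_nonneg (sub_nonneg.2 hγ') (mul_nonneg hM hb),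
      mul_nonneg (sub_nonneg.2 hγ') (mul_nonneg ha ha),
      mul_nonneg (sub_nonneg.2 hγ') (mul_nonneg hb hb),
      mul_nonneg hγ (sq_nonneg (a - b))]


/-- A non-integrable function has integral `0` by convention, so integrability of the magnetic
integrand need not be shown. -/
lemma integral_re_nonneg {α : Type*} [MeasurableSpace α] {μ : Measure α} {F : α → ℂ}
    (h : ∀ᵐ x ∂μ, 0 ≤ (F x).re) : 0 ≤ (∫ x, F x ∂μ).re := by
  by_cases hF : Integrable F μ
  · rw [show (∫ x, F x ∂μ).re = ∫ x, (F x).re ∂μ from (integral_re hF).symm]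
    exact integral_nonneg_of_ae h
  · simp [integral_undef hF]

/-- The magnetic form of `u` against its truncation `(u - M)⁺` is nonnegative, provided the
truncation vanishes outside `B_r(0)`. -/
lemma magneticForm_truncation_nonneg (hn : 0 < n) {s r M : ℝ} (hs : 0 < s) (hr : 0 < r)
    (hM : 0 ≤ M) {A : E n → E n}
    (hA0 : ∀ᵐ x, x ∉ Metric.ball (0 : E n) r → A x = 0)
    (hA : ∀ᵐ x, ∀ j : Fin n, |A x j| ≤ Real.pi / (8 * √n * r)) {u : E n → ℝ}
    (hu : ∀ᵐ x, x ∉ Metric.ball (0 : E n) r → max (u x - M) 0 = 0) :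
    0 ≤ magneticForm s A u (fun x => max (u x - M) 0) := by
  refine integral_re_nonneg ?_
  filter_upwards [ae_cos_phase_nonneg hn hr hA0 hA, ae_prod_of_ae hu] with z hz hz0
  rw [integrand_re]
  refine mul_nonneg ?_ (div_nonneg (kernelConst_nonneg n hs) (by positivity))
  by_cases h : z.1 ∈ Metric.ball 0 r ∨ z.2 ∈ Metric.ball 0 r
  · exact integrand_nonneg (hz h) (Real.cos_le_one _) hM
  · rw [not_or] at h
    rw [hz0.1 h.1, hz0.2 h.2]
    simp

/-! ### The maximum principle -/

lemma MemHs.memLp {s : ℝ} {u : E n → ℝ} (hu : MemHs s u) : MemLp u 2 volume := by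
  obtain ⟨hm, hE⟩ := memHs_iff.1 hu
  exact memLp_two_of_sobolevEnergy_lt_top hm hE

/-- Truncation is 1-Lipschitz and, since `0 ≤ M`, does not increase absolute values. -/
lemma MemHs.truncation {s M : ℝ} (hM : 0 ≤ M) {u : E n → ℝ} (hu : MemHs s u) :
    MemHs s (fun x => max (u x - M) 0) := by
  obtain ⟨hm, hE⟩ := memHs_iff.1 hu
  refine memHs_iff.2 ⟨?_, (sobolevEnergy_mono (Eventually.of_forall fun x => ?_)
    (Eventually.of_forall fun z => ?_)).trans_lt hE⟩
  · exact (hm.sub aestronglyMeasurable_const).sup aestronglyMeasurable_const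
  · rw [abs_of_nonneg (le_max_right _ _)]
    exact max_le (by linarith [le_abs_self (u x)]) (abs_nonneg _)
  · refine (abs_max_sub_max_le_max _ _ _ _).trans ?_
    simp

lemma ae_abs_le_toReal_eLpNorm_top {α : Type*} [MeasurableSpace α] {μ : Measure α} {f : α → ℝ}
    (hf : MemLp f ⊤ μ) : ∀ᵐ x ∂μ, |f x| ≤ (eLpNorm f ⊤ μ).toReal := by
  have h := ae_le_eLpNormEssSup (f := f) (μ := μ)
  filter_upwards [h] with x hx
  rw [← eLpNorm_exponent_top] at hx
  have := ENNReal.toReal_mono hf.2.ne hx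
  simpa using this

/-- The one-sided maximum principle. -/
lemma IsWeakSolution.ae_le (hn : 0 < n) {s : ℝ} (hs : 0 < s) (hs' : s < 1) {Ω : Set (E n)}
    (hΩ : IsBoundedC11Domain Ω) {r : ℝ} (hr : 0 < r) (hΩr : Ω ⊆ Metric.ball 0 r) {A : E n → E n}
    (hA0 : ∀ᵐ x, x ∉ Metric.ball (0 : E n) r → A x = 0)
    (hA : ∀ᵐ x, ∀ j : Fin n, |A x j| ≤ Real.pi / (8 * √n * r)) {q f g u : E n → ℝ}
    (hq : MemLp q ⊤ (volume.restrict Ω)) {c : ℝ} (hc : 0 < c)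
    (hqc : ∀ᵐ x ∂(volume.restrict Ω), c ≤ q x) (hf : MemLp f ⊤ (volume.restrict Ω))
    (hu : IsWeakSolution s A Ω q f g u) {F G : ℝ} (hF0 : 0 ≤ F) (hG0 : 0 ≤ G)
    (hF : ∀ᵐ x ∂(volume.restrict Ω), f x ≤ F) (hG : ∀ᵐ x ∂(volume.restrict (exterior Ω)), g x ≤ G) :
    ∀ᵐ x, u x ≤ F / c + G := by
  -- The summand `G` makes the truncation vanish in the exterior; `F / c` ensures `F ≤ c * M`.
  set M : ℝ := F / c + G with hM
  have hM0 : 0 ≤ M := by positivity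
  set v : E n → ℝ := fun x => max (u x - M) 0 with hv
  have hv0 : ∀ᵐ x, x ∉ Ω → v x = 0 := by
    have hext : ∀ᵐ x, x ∈ exterior Ω → u x ≤ G := by
      have hme : MeasurableSet (exterior Ω) := isClosed_closure.isOpen_compl.measurableSet
      rw [← ae_restrict_iff' hme]
      filter_upwards [hu.eq_exterior, hG] with x h1 h2
      rwa [h1]
    have hfr : ∀ᵐ x, x ∉ frontier Ω := measure_eq_zero_iff_ae_notMem.1 hΩ.volume_frontier
    filter_upwards [hext, hfr] with x h1 h2 hxΩ
    have hxc : x ∈ exterior Ω := fun hxc => h2 (by rw [hΩ.isOpen.frontier_eq]; exact ⟨hxc, hxΩ⟩)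
    refine max_eq_right ?_
    have : 0 ≤ F / c := by positivity
    linarith [h1 hxc]
  have hvHs : MemHs s v := hu.memHs.truncation hM0
  have hweak := hu.weak_eq v (memHsTilde_of_ae_eq_zero hn hs hs' hΩ hvHs hv0)
  have hform : 0 ≤ magneticForm s A u v := by
    refine magneticForm_truncation_nonneg hn hs hr hM0 hA0 hA ?_
    filter_upwards [hv0] with x hx hxr using hx fun h => hxr (hΩr h)
  have : IsFiniteMeasure (volume.restrict Ω) := ⟨by
    rw [Measure.restrict_apply_univ]; exact hΩ.isBounded.measure_lt_top⟩
  have hu2 : MemLp u 2 (volume.restrict Ω) := hu.memHs.memLp.restrict _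
  have hv2 : MemLp v 2 (volume.restrict Ω) := hvHs.memLp.restrict _
  have hquv : Integrable (fun x => q x * u x * v x) (volume.restrict Ω) :=
    (hu2.mul hq (r := 2)).integrable_mul hv2
  have hfv : Integrable (fun x => f x * v x) (volume.restrict Ω) :=
    (hf.mono_exponent (p := 2) le_top).integrable_mul hv2
  have hv2i : Integrable (fun x => c * v x ^ 2) (volume.restrict Ω) :=
    hv2.integrable_sq.const_mul c
  have hpt : ∀ᵐ x ∂(volume.restrict Ω), c * v x ^ 2 ≤ q x * u x * v x - f x * v x := by
    filter_upwards [hqc, hF] with x h1 h2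
    rcases le_total (u x - M) 0 with h | h
    · simp [hv, max_eq_right h]
    · have hvx : v x = u x - M := max_eq_left h
      have hcM : F ≤ c * M := by
        have : c * M = F + c * G := by rw [hM]; field_simp
        have : 0 ≤ c * G := by positivity
        linarith
      -- Here `0 ≤ M ≤ u x` is essential: the lower bound on `q` may only be multiplied by a
      -- nonnegative value.
      have hqu : c * u x ≤ q x * u x := by gcongr; linarith
      have : c * v x ≤ q x * u x - f x := by rw [hvx]; linarith
      calc c * v x ^ 2 = c * v x * v x := by ring
        _ ≤ (q x * u x - f x) * v x := by gcongr
        _ = _ := by ring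
  have hint : ∫ x in Ω, c * v x ^ 2 ≤ 0 := by
    refine (integral_mono_ae hv2i (hquv.sub hfv) hpt).trans ?_
    rw [integral_sub' hquv hfv]
    linarith
  have hzero : ∀ᵐ x ∂(volume.restrict Ω), c * v x ^ 2 = 0 :=
    (integral_eq_zero_iff_of_nonneg (fun x => by positivity) hv2i).1
      (le_antisymm hint (integral_nonneg fun x => by positivity))
  rw [ae_restrict_iff' hΩ.isOpen.measurableSet] at hzero
  filter_upwards [hv0, hzero] with x h1 h2
  have hvx : v x = 0 := by
    by_cases hx : x ∈ Ω
    · have := h2 hx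
      simpa [hc.ne'] using this
    · exact h1 hx
  have : u x - M ≤ v x := le_max_left _ _
  linarith

lemma magneticForm_neg_left (s : ℝ) (A : E n → E n) (u v : E n → ℝ) :
    magneticForm s A (fun x => -u x) v = -magneticForm s A u v := by
  unfold magneticForm
  rw [← Complex.neg_re, ← integral_neg]
  congr 2
  ext z
  push_cast
  ring

lemma MemHs.neg {s : ℝ} {u : E n → ℝ} (hu : MemHs s u) : MemHs s (fun x => -u x) := by
  obtain ⟨hm, hE⟩ := memHs_iff.1 hu
  refine memHs_iff.2 ⟨hm.neg, (sobolevEnergy_mono (Eventually.of_forall fun x => ?_)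
    (Eventually.of_forall fun z => ?_)).trans_lt hE⟩
  · rw [abs_neg]
  · rw [← neg_sub', abs_neg]

/-- Turns the one-sided bound into a two-sided one. -/
lemma IsWeakSolution.neg {s : ℝ} {A : E n → E n} {Ω : Set (E n)} {q f g u : E n → ℝ}
    (hu : IsWeakSolution s A Ω q f g u) :
    IsWeakSolution s A Ω q (fun x => -f x) (fun x => -g x) (fun x => -u x) where
  memHs := hu.memHs.neg
  eq_exterior := by
    filter_upwards [hu.eq_exterior] with x hx
    rw [hx]
  weak_eq v hv := by
    have h := hu.weak_eq v hv
    rw [magneticForm_neg_left]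
    simp only [mul_neg, neg_mul, integral_neg]
    linarith

end FracMagnetic


theorem proposition3p6 (c : ℝ) (hc : 0 < c) :
    ∃ C : ℝ, 0 < C ∧
      ∀ (n : ℕ) (_ : 2 ≤ n) (s : ℝ) (_ : 0 < s) (_ : s < 1)
        (Ω : Set (FracMagnetic.E n)) (_ : FracMagnetic.IsBoundedC11Domain Ω)
        (r : ℝ) (_ : 0 < r) (_ : Ω ⊆ Metric.ball 0 r)
        (A : FracMagnetic.E n → FracMagnetic.E n)
        (_ : AEStronglyMeasurable A volume)
        (_ : ∀ᵐ x, x ∉ Metric.ball (0 : FracMagnetic.E n) r → A x = 0)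
        (_ : ∀ᵐ x, ∀ j : Fin n, |A x j| ≤ Real.pi / (8 * Real.sqrt n * r))
        (q : FracMagnetic.E n → ℝ)
        (_ : MemLp q ⊤ (volume.restrict Ω))
        (_ : ∀ᵐ x ∂(volume.restrict Ω), c ≤ q x)
        (f : FracMagnetic.E n → ℝ) (_ : MemLp f ⊤ (volume.restrict Ω))
        (g : FracMagnetic.E n → ℝ)
        (_ : FracMagnetic.IsTestFunction (FracMagnetic.exterior Ω) g)
        (u : FracMagnetic.E n → ℝ)
        (_ : FracMagnetic.IsWeakSolution s A Ω q f g u),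
        eLpNorm u ⊤ volume ≤
          ENNReal.ofReal C * eLpNorm f ⊤ (volume.restrict Ω) +
            eLpNorm g ⊤ (volume.restrict (FracMagnetic.exterior Ω)) := by
  refine ⟨1 / c, by positivity, ?_⟩
  intro n hn s hs hs' Ω hΩ r hr hΩr A _ hA0 hA q hq hqc f hf g hg u hu
  have hgL : MemLp g ⊤ (volume.restrict (FracMagnetic.exterior Ω)) :=
    (hg.contDiff.continuous.memLp_top_of_hasCompactSupport hg.hasCompactSupport volume).restrict _
  have hF := FracMagnetic.ae_abs_le_toReal_eLpNorm_top hf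
  have hG := FracMagnetic.ae_abs_le_toReal_eLpNorm_top hgL
  set F := (eLpNorm f ⊤ (volume.restrict Ω)).toReal with hFdef
  set G := (eLpNorm g ⊤ (volume.restrict (FracMagnetic.exterior Ω))).toReal with hGdef
  have hF0 : 0 ≤ F := ENNReal.toReal_nonneg
  have hG0 : 0 ≤ G := ENNReal.toReal_nonneg
  have h1 := hu.ae_le (by omega) hs hs' hΩ hr hΩr hA0 hA hq hc hqc hf hF0 hG0
    (hF.mono fun x hx => (abs_le.1 hx).2) (hG.mono fun x hx => (abs_le.1 hx).2)
  have h2 := hu.neg.ae_le (by omega) hs hs' hΩ hr hΩr hA0 hA hq hc hqc hf.neg hF0 hG0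
    (hF.mono fun x hx => neg_le.1 (abs_le.1 hx).1) (hG.mono fun x hx => neg_le.1 (abs_le.1 hx).1)
  calc eLpNorm u ⊤ volume ≤ ENNReal.ofReal (F / c + G) := by
        rw [eLpNorm_exponent_top]
        refine eLpNormEssSup_le_of_ae_bound ?_
        filter_upwards [h1, h2] with x hx1 hx2
        exact abs_le.2 ⟨by linarith, hx1⟩
    _ = _ := by
        rw [ENNReal.ofReal_add (by positivity) hG0, hGdef, ENNReal.ofReal_toReal hgL.2.ne,
          div_eq_inv_mul, ENNReal.ofReal_mul (by positivity), hFdef, ENNReal.ofReal_toReal hf.2.ne,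
          one_div]
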